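/- All graphs are finite, undirected and simple. For a graph $G$, the $m$-degree $m(G)$ is the largest integer $k$ such that $G$ has at least $k$ vertices of degree at least $k-1$. A vertex of $G$ is dense if its degree is at least $m(G)-1$, and $G$ is tight if it has exactly $m(G)$ dense vertices, each of which has degree exactly $m(G)-1$. A b-colouring of $G$ is a map $c:V(G)\to\{1,2,\ldots\}$ with $c(u)\neq c(v)$ for every edge $uv$ such that every colour $i\in c(V(G))$ has a vertex of colour $i$ that is adjacent to a vertex of every colour $j\in c(V(G))\setminus\{i\}$. A tight b-colouring of $G$ is a b-colouring with exactly $m(G)$ colours, that is, with $|c(V(G))|=m(G)$. The problem Tight b-Chromatic Number is to decide, given a tight graph $G$, whether $G$ has a tight b-colouring. **Lemma.** Tight b-Chromatic Number is polynomial-time solvable for $(2P_2+P_1)$-free graphs, that is, for graphs with no induced subgraph isomorphic to the disjoint union of two edges and an isolated vertex. In other words, there are an algorithm and a polynomial $p$ such that, for every tight $(2P_2+P_1)$-free graph $G$ on $n$ vertices, the algorithm, given $G$, decides within $p(n)$ steps whether $G$ has a tight b-colouring. -/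

import Mathlib

/-! ## Graph notions -/

namespace TightB

section Graph

variable {V : Type*} [Fintype V] (G : SimpleGraph V)

open Classical in
/-- The `m`-degree `m(G)`: the largest `k` such that at least `k` vertices have degree at
least `k - 1` (written `k ≤ degree + 1`, which avoids truncated subtraction). The set is
bounded by the number of vertices and contains `0`. -/
noncomputable def mDegree : ℕ :=
  sSup {k : ℕ | k ≤ (Finset.univ.filter fun v : V => k ≤ G.degree v + 1).card}

open Classical in
/-- A vertex is dense if its degree is at least `m(G) - 1`. -/
def IsDense (v : V) : Prop :=
  mDegree G ≤ G.degree v + 1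

open Classical in
/-- `G` is tight if it has exactly `m(G)` dense vertices, each of degree exactly `m(G) - 1`. -/
def IsTight : Prop :=
  (Finset.univ.filter fun v : V => IsDense G v).card = mDegree G ∧
    ∀ v : V, IsDense G v → G.degree v + 1 = mDegree G

variable {G}

/-- `v` is b-chromatic under `c` if it has a neighbour of every colour used by `c` other
than its own colour. -/
def IsBChromaticVertex (c : G.Coloring ℕ+) (v : V) : Prop :=
  ∀ j ∈ Set.range c, j ≠ c v → ∃ w, G.Adj v w ∧ c w = j

/-- A b-colouring: every colour class contains a b-chromatic vertex. -/
def IsBColouring (c : G.Coloring ℕ+) : Prop :=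
  ∀ i ∈ Set.range c, ∃ v, c v = i ∧ IsBChromaticVertex c v

/-- A tight b-colouring: a b-colouring that uses exactly `m(G)` colours. -/
def IsTightBColouring (c : G.Coloring ℕ+) : Prop :=
  IsBColouring c ∧ (Set.range c).ncard = mDegree G

variable (G)

/-- `G` has a tight b-colouring. -/
def HasTightBColouring : Prop :=
  ∃ c : G.Coloring ℕ+, IsTightBColouring c

end Graph

open SimpleGraph in
/-- The graph `2P₂ + P₁`: the disjoint union of two edges and an isolated vertex. -/
def twoP2AddP1 : SimpleGraph ((Fin 2 ⊕ Fin 2) ⊕ Fin 1) :=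
  (pathGraph 2 ⊕g pathGraph 2) ⊕g pathGraph 1

/-- `G` is `H`-free: `H` is not isomorphic to an induced subgraph of `G`. -/
def IsFreeOf {W V : Type*} (H : SimpleGraph W) (G : SimpleGraph V) : Prop :=
  ¬ H.IsIndContained G

/-! ## Machine model

A random access machine with the uniform cost measure, programmed by structured programs.
The machine has registers `0, 1, 2, …` and arrays `0, 1, 2, …` of unbounded length, all
holding natural numbers; a program refers to finitely many registers and arrays, and array
cells are addressed indirectly. The only arithmetic is addition and truncated subtraction,
so that the bit length of the stored numbers grows by at most a constant per step and
polynomial time is the usual polynomial time. -/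

/-- Memory contents. -/
structure State where
  /-- the registers -/
  reg : ℕ → ℕ
  /-- the arrays; `arr a i` is cell `i` of array `a` -/
  arr : ℕ → ℕ → ℕ

/-- Overwrite register `r` by `x`. -/
def State.setReg (s : State) (r x : ℕ) : State :=
  { s with reg := Function.update s.reg r x }

/-- Overwrite cell `i` of array `a` by `x`. -/
def State.setArr (s : State) (a i x : ℕ) : State :=
  { s with arr := Function.update s.arr a (Function.update (s.arr a) i x) }

/-- Expressions: constants, registers, array cells with a computed index, sums and truncated
differences. -/
inductive Expr where
  | lit (x : ℕ)
  | reg (r : ℕ)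
  | cell (a : ℕ) (i : Expr)
  | plus (e f : Expr)
  | minus (e f : Expr)

/-- The value of an expression. -/
def Expr.eval (s : State) : Expr → ℕ
  | .lit x => x
  | .reg r => s.reg r
  | .cell a i => s.arr a (i.eval s)
  | .plus e f => e.eval s + f.eval s
  | .minus e f => e.eval s - f.eval s

/-- The cost of evaluating an expression: one step for each of its nodes. -/
def Expr.cost : Expr → ℕ
  | .lit _ => 1
  | .reg _ => 1
  | .cell _ i => i.cost + 1
  | .plus e f => e.cost + f.cost + 1
  | .minus e f => e.cost + f.cost + 1

/-- Programs. A test succeeds if its value is nonzero. -/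
inductive Prog where
  | skip
  | assign (r : ℕ) (e : Expr)
  | store (a : ℕ) (i e : Expr)
  | seq (p q : Prog)
  | ite (b : Expr) (p q : Prog)
  | loop (b : Expr) (p : Prog)

/-- `Exec p s s' t`: program `p`, started in state `s`, halts in state `s'` after exactly
`t` steps. -/
inductive Exec : Prog → State → State → ℕ → Prop where
  | skip (s : State) : Exec .skip s s 1
  | assign (r : ℕ) (e : Expr) (s : State) :
      Exec (.assign r e) s (s.setReg r (e.eval s)) (e.cost + 1)
  | store (a : ℕ) (i e : Expr) (s : State) :
      Exec (.store a i e) s (s.setArr a (i.eval s) (e.eval s)) (i.cost + e.cost + 1)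
  | seq {p q : Prog} {s s' s'' : State} {t t' : ℕ}
      (hp : Exec p s s' t) (hq : Exec q s' s'' t') : Exec (.seq p q) s s'' (t + t')
  | ite_true {b : Expr} {p q : Prog} {s s' : State} {t : ℕ}
      (hb : b.eval s ≠ 0) (hp : Exec p s s' t) : Exec (.ite b p q) s s' (b.cost + 1 + t)
  | ite_false {b : Expr} {p q : Prog} {s s' : State} {t : ℕ}
      (hb : b.eval s = 0) (hq : Exec q s s' t) : Exec (.ite b p q) s s' (b.cost + 1 + t)
  | loop_true {b : Expr} {p : Prog} {s s' s'' : State} {t t' : ℕ}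
      (hb : b.eval s ≠ 0) (hp : Exec p s s' t) (hl : Exec (.loop b p) s' s'' t') :
      Exec (.loop b p) s s'' (b.cost + 1 + t + t')
  | loop_false {b : Expr} {p : Prog} {s : State}
      (hb : b.eval s = 0) : Exec (.loop b p) s s (b.cost + 1)

/-- Execution is deterministic: the final state and the number of steps are determined by
the program and the initial state. -/
theorem Exec.deterministic {p : Prog} {s s₁ s₂ : State} {t₁ t₂ : ℕ}
    (h₁ : Exec p s s₁ t₁) (h₂ : Exec p s s₂ t₂) : s₁ = s₂ ∧ t₁ = t₂ := by
  induction h₁ generalizing s₂ t₂ with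
  | skip => cases h₂; exact ⟨rfl, rfl⟩
  | assign => cases h₂; exact ⟨rfl, rfl⟩
  | store => cases h₂; exact ⟨rfl, rfl⟩
  | seq _ _ ihp ihq =>
    cases h₂ with
    | seq hp hq =>
      obtain ⟨rfl, rfl⟩ := ihp hp
      obtain ⟨rfl, rfl⟩ := ihq hq
      exact ⟨rfl, rfl⟩
  | ite_true hb _ ih =>
    cases h₂ with
    | ite_true _ hp => obtain ⟨rfl, rfl⟩ := ih hp; exact ⟨rfl, rfl⟩
    | ite_false hb' _ => exact absurd hb' hb
  | ite_false hb _ ih =>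
    cases h₂ with
    | ite_true hb' _ => exact absurd hb hb'
    | ite_false _ hq => obtain ⟨rfl, rfl⟩ := ih hq; exact ⟨rfl, rfl⟩
  | loop_true hb _ _ ihp ihl =>
    cases h₂ with
    | loop_true _ hp hl =>
      obtain ⟨rfl, rfl⟩ := ihp hp
      obtain ⟨rfl, rfl⟩ := ihl hl
      exact ⟨rfl, rfl⟩
    | loop_false hb' => exact absurd hb' hb
  | loop_false hb =>
    cases h₂ with
    | loop_true hb' _ _ => exact absurd hb hb'
    | loop_false _ => exact ⟨rfl, rfl⟩

open Classical in
/-- The input state for a graph on the vertices `0, …, n - 1`: register `0` holds `n`, array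
`0` holds the adjacency matrix row by row (cell `i * n + j` is `1` if `i` and `j` are
adjacent and `0` otherwise), and everything else is `0`. -/
noncomputable def inputState {n : ℕ} (G : SimpleGraph (Fin n)) : State where
  reg r := if r = 0 then n else 0
  arr a k := if a = 0 ∧ ∃ i j : Fin n, G.Adj i j ∧ k = i * n + j then 1 else 0

/-- The decision problem "does `G` satisfy `P`?", restricted to input graphs in the class
`C`, is solvable in polynomial time: one program halts on every finite graph of the class
within a number of steps that is polynomial in the number of vertices, and leaves the
answer (`1` for yes, `0` for no) in register `0`. -/
def PolyTimeSolvableOn (C P : ∀ {n : ℕ}, SimpleGraph (Fin n) → Prop) : Prop :=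
  ∃ (prog : Prog) (time : Polynomial ℕ), ∀ (n : ℕ) (G : SimpleGraph (Fin n)), C G →
    ∃ (s : State) (t : ℕ), Exec prog (inputState G) s t ∧ t ≤ time.eval n ∧
      (P G → s.reg 0 = 1) ∧ (¬ P G → s.reg 0 = 0)

end TightB

/-!
In a tight b-colouring of a tight graph every dense vertex has its own colour and sees every other
colour exactly once. Naming the colours after the dense vertices, such a colouring is determined, up
to a greedy extension, by its values on the boundary, that is, on the non-dense vertices with a
dense neighbour; the dense neighbours of a boundary vertex of colour `d` are dense non-neighbours of
`d`.

In a `(2P₂ + P₁)`-free graph at most one colour `d` is repeated on the boundary. Every other colour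
`e` that is missing at some dense vertex then appears on a single boundary vertex, whose dense
neighbours are exactly the dense non-neighbours of `e`. Boundary vertices with the same dense
neighbours are interchangeable here, so these vertices exist as soon as there are enough of each
kind, and all boundary vertices left over can take the colour `d` once they are independent. Trying
all `d` leaves independence and counting conditions, which are decided by nested loops over the
vertices.
-/

namespace TightB

/-! ### Polynomial-time computation on graphs with marked vertices -/

section Machine

/-- `s` and `s'` hold the same data in all arrays and in the registers `0, …, j`. -/
structure State.AgreeUpTo (j : ℕ) (s s' : State) : Prop where
  arr : s'.arr = s.arr
  reg : ∀ r ≤ j, s'.reg r = s.reg r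

namespace State.AgreeUpTo

variable {i j : ℕ} {s s₁ s₂ : State}

theorem refl (j : ℕ) (s : State) : AgreeUpTo j s s :=
  ⟨rfl, fun _ _ => rfl⟩

theorem trans (h₁ : AgreeUpTo j s s₁) (h₂ : AgreeUpTo j s₁ s₂) : AgreeUpTo j s s₂ :=
  ⟨h₂.arr.trans h₁.arr, fun r hr => (h₂.reg r hr).trans (h₁.reg r hr)⟩

theorem mono (hij : i ≤ j) (h : AgreeUpTo j s s₁) : AgreeUpTo i s s₁ :=
  ⟨h.arr, fun r hr => h.reg r (hr.trans hij)⟩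

theorem setReg (h : AgreeUpTo j s s₁) {r : ℕ} (hr : j < r) (x : ℕ) :
    AgreeUpTo j s (s₁.setReg r x) :=
  ⟨h.arr, fun q hq => (Function.update_of_ne (hq.trans_lt hr).ne _ _).trans (h.reg q hq)⟩

end State.AgreeUpTo

/-- Started in `s`, the program `p` halts within `T` steps with `v` in register `j + 1`; the
arrays and the registers `0, …, j` are left unchanged. -/
def Computes (p : Prog) (j v T : ℕ) (s : State) : Prop :=
  ∃ s' t, Exec p s s' t ∧ t ≤ T ∧ s.AgreeUpTo j s' ∧ s'.reg (j + 1) = v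

variable {p q : Prog} {i j v w T U : ℕ} {s : State} {e : Expr}

theorem computes_assign (e : Expr) (j : ℕ) (s : State) :
    Computes (.assign (j + 1) e) j (e.eval s) (e.cost + 1) s :=
  ⟨_, _, .assign _ _ _, le_rfl, (State.AgreeUpTo.refl j s).setReg j.lt_succ_self _,
    Function.update_self _ _ _⟩

theorem Computes.seq (hp : Computes p i v T s) (hij : j ≤ i)
    (hq : ∀ s', s.AgreeUpTo i s' → s'.reg (i + 1) = v → Computes q j w U s') :
    Computes (.seq p q) j w (T + U) s := by
  obtain ⟨s₁, t₁, hp, ht₁, hs₁, hv⟩ := hp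
  obtain ⟨s₂, t₂, hq, ht₂, hs₂, hw⟩ := hq s₁ hs₁ hv
  exact ⟨s₂, t₁ + t₂, .seq hp hq, add_le_add ht₁ ht₂, (hs₁.mono hij).trans hs₂, hw⟩

/-- While the counter in register `j + 2` is below register `0`, add the value that `p`
leaves in register `j + 3` to register `j + 1` and increment the counter. -/
def sumLoop (p : Prog) (j : ℕ) : Prog :=
  .loop (.minus (.reg 0) (.reg (j + 2)))
    (.seq p (.seq (.assign (j + 1) (.plus (.reg (j + 1)) (.reg (j + 3))))
      (.assign (j + 2) (.plus (.reg (j + 2)) (.lit 1)))))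

theorem Computes.exec_accumulate (hp : Computes p (j + 2) v T s) :
    ∃ s' t, Exec (.seq p (.seq (.assign (j + 1) (.plus (.reg (j + 1)) (.reg (j + 3))))
        (.assign (j + 2) (.plus (.reg (j + 2)) (.lit 1))))) s s' t ∧ t ≤ T + 8 ∧
      s.AgreeUpTo j s' ∧ s'.reg (j + 1) = s.reg (j + 1) + v ∧
      s'.reg (j + 2) = s.reg (j + 2) + 1 := by
  obtain ⟨s₁, t, hp, ht, hs₁, hv⟩ := hp
  refine ⟨_, _, .seq hp (.seq (.assign _ _ _) (.assign _ _ _)), ?_,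
    ((hs₁.mono (by omega)).setReg (by omega) _).setReg (by omega) _, ?_, ?_⟩
  · simp only [Expr.cost]
    omega
  · simp [State.setReg, Expr.eval, hs₁.reg, hv]
  · simp [State.setReg, Expr.eval, hs₁.reg]

theorem computes_sumLoop {n : ℕ} {f : ℕ → ℕ} {s₀ : State} (hn : s₀.reg 0 = n)
    (hp : ∀ s, s₀.AgreeUpTo j s → s.reg (j + 2) < n →
      Computes p (j + 2) (f (s.reg (j + 2))) T s)
    (m : ℕ) (s : State) (hs : s₀.AgreeUpTo j s) (hm : s.reg (j + 2) + m = n) :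
    Computes (sumLoop p j) j
      (s.reg (j + 1) + ∑ i ∈ Finset.range m, f (s.reg (j + 2) + i)) (m * (T + 12) + 4) s := by
  have h0 : s.reg 0 = n := (hs.reg 0 j.zero_le).trans hn
  induction m generalizing s with
  | zero =>
    refine ⟨s, _, .loop_false ?_, ?_, .refl j s, by simp⟩ <;>
    simp only [Expr.eval, Expr.cost] <;> omega
  | succ m ih =>
    obtain ⟨s₁, t₁, hbody, ht₁, hs₁, hacc, hcount⟩ := (hp s hs (by omega)).exec_accumulate
    obtain ⟨s₂, t₂, hloop, ht₂, hs₂, hv⟩ := ih s₁ (hs.trans hs₁) (by omega)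
      ((hs₁.reg 0 j.zero_le).trans h0)
    refine ⟨s₂, _, .loop_true ?_ hbody hloop, ?_, hs₁.trans hs₂, ?_⟩
    · simp only [Expr.eval]
      omega
    · simp only [Expr.cost]
      linarith
    · rw [hv, hacc, hcount, Finset.sum_range_succ', add_zero, add_assoc, add_comm (f _)]
      simp only [add_assoc, add_comm 1]

end Machine

section PolyTime

variable {k l : ℕ}

/-- The state `s` holds the graph `G` as in `inputState G` and the vertices `x 0, x 1, …` in
the registers `ρ 0, ρ 1, …`. -/
structure State.Stores (s : State) {n : ℕ} (G : SimpleGraph (Fin n)) (ρ : Fin k → ℕ)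
    (x : Fin k → Fin n) : Prop where
  arr : s.arr = (inputState G).arr
  size : s.reg 0 = n
  vertex : ∀ i, s.reg (ρ i) = x i

theorem State.Stores.of_agreeUpTo {s s' : State} {n j : ℕ} {G : SimpleGraph (Fin n)}
    {ρ : Fin k → ℕ} {x : Fin k → Fin n} (h : s.Stores G ρ x) (hρ : ∀ i, ρ i ≤ j)
    (hs : s.AgreeUpTo j s') : s'.Stores G ρ x :=
  ⟨hs.arr.trans h.arr, (hs.reg 0 j.zero_le).trans h.size,
    fun i => (hs.reg _ (hρ i)).trans (h.vertex i)⟩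

/-- A number that depends on a graph and `k` of its vertices can be computed in polynomial
time, wherever in the registers `0, …, j` the vertices are stored. -/
def PolyTimeComputable
    (f : ∀ {n : ℕ}, SimpleGraph (Fin n) → (Fin k → Fin n) → ℕ) : Prop :=
  ∀ (ρ : Fin k → ℕ) (j : ℕ), (∀ i, ρ i ≤ j) → ∃ (p : Prog) (time : Polynomial ℕ),
    ∀ {n : ℕ} (G : SimpleGraph (Fin n)) (x : Fin k → Fin n) (s : State), s.Stores G ρ x →
      Computes p j (f G x) (time.eval n) s

open Classical in
/-- A property of a graph and `k` of its vertices can be decided in polynomial time. -/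
def PolyTimeDecidable
    (P : ∀ {n : ℕ}, SimpleGraph (Fin n) → (Fin k → Fin n) → Prop) : Prop :=
  PolyTimeComputable fun G x => if P G x then 1 else 0

namespace PolyTimeComputable

variable {f g : ∀ {n : ℕ}, SimpleGraph (Fin n) → (Fin k → Fin n) → ℕ}

theorem congr (hf : PolyTimeComputable f)
    (hfg : ∀ {n : ℕ} (G : SimpleGraph (Fin n)) (x : Fin k → Fin n), f G x = g G x) :
    PolyTimeComputable g := by
  have : @f = @g := by
    funext n G x
    exact hfg G x
  exact this ▸ hf

theorem const (c : ℕ) : PolyTimeComputable (k := k) fun _ _ => c := fun _ j _ =>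
  ⟨.assign (j + 1) (.lit c), 2, fun _ _ s _ => by
    simpa [Expr.eval, Expr.cost] using computes_assign (.lit c) j s⟩

theorem vertex (i : Fin k) : PolyTimeComputable fun _ x => (x i : ℕ) := fun ρ j _ =>
  ⟨.assign (j + 1) (.reg (ρ i)), 2, fun _ _ s hs => by
    simpa [Expr.eval, Expr.cost, hs.vertex] using computes_assign (.reg (ρ i)) j s⟩

theorem cell (hf : PolyTimeComputable f) :
    PolyTimeComputable fun G x => (inputState G).arr 0 (f G x) := by
  intro ρ j hρ
  obtain ⟨p, time, hp⟩ := hf ρ j hρ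
  refine ⟨.seq p (.assign (j + 1) (.cell 0 (.reg (j + 1)))), time + 3, fun G x s hs => ?_⟩
  have hseq := (hp G x s hs).seq le_rfl (q := .assign (j + 1) (.cell 0 (.reg (j + 1))))
    (w := (inputState G).arr 0 (f G x)) (U := 3) fun s' hs' hv => by
      simpa [Expr.eval, Expr.cost, hv, hs'.arr, hs.arr] using
        computes_assign (.cell 0 (.reg (j + 1))) j s'
  simpa using hseq

theorem binary {op : ℕ → ℕ → ℕ} {e : ℕ → ℕ → Expr}
    (he : ∀ a b s, (e a b).eval s = op (s.reg a) (s.reg b)) (hc : ∀ a b, (e a b).cost = 3)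
    (hf : PolyTimeComputable f) (hg : PolyTimeComputable g) :
    PolyTimeComputable fun G x => op (f G x) (g G x) := by
  intro ρ j hρ
  obtain ⟨p, time, hp⟩ := hf ρ j hρ
  obtain ⟨q, time', hq⟩ := hg ρ (j + 1) fun i => (hρ i).trans j.le_succ
  refine ⟨.seq p (.seq q (.assign (j + 1) (e (j + 1) (j + 2)))), time + (time' + 4),
    fun {n} G x s hs => ?_⟩
  simp only [Polynomial.eval_add, Polynomial.eval_ofNat]
  refine (hp G x s hs).seq le_rfl fun s₁ hs₁ hf₁ => ?_
  refine (hq G x s₁ (hs.of_agreeUpTo hρ hs₁)).seq j.le_succ fun s₂ hs₂ hg₂ => ?_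
  simpa [he, hc, hs₂.reg (j + 1) le_rfl, hf₁, hg₂] using
    computes_assign (e (j + 1) (j + 2)) j s₂

theorem add (hf : PolyTimeComputable f) (hg : PolyTimeComputable g) :
    PolyTimeComputable fun G x => f G x + g G x :=
  binary (e := fun a b => .plus (.reg a) (.reg b)) (fun _ _ _ => rfl) (fun _ _ => rfl) hf hg

theorem sub (hf : PolyTimeComputable f) (hg : PolyTimeComputable g) :
    PolyTimeComputable fun G x => f G x - g G x :=
  binary (e := fun a b => .minus (.reg a) (.reg b)) (fun _ _ _ => rfl) (fun _ _ => rfl) hf hg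

theorem sum {f : ∀ {n : ℕ}, SimpleGraph (Fin n) → (Fin k → Fin n) → Fin n → ℕ}
    (hf : PolyTimeComputable fun G (x : Fin (k + 1) → _) => f G (Fin.tail x) (x 0)) :
    PolyTimeComputable fun G x => ∑ v, f G x v := by
  intro ρ j hρ
  have hρ' : ∀ i, (Fin.cons (j + 2) ρ : Fin (k + 1) → ℕ) i ≤ j + 2 :=
    Fin.cases le_rfl fun i => (hρ i).trans (Nat.le_add_right j 2)
  obtain ⟨p, time, hp⟩ := hf (Fin.cons (j + 2) ρ) (j + 2) hρ'
  refine ⟨.seq (.assign (j + 1) (.lit 0)) (.seq (.assign (j + 2) (.lit 0)) (sumLoop p j)),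
    2 + (2 + (.X * (time + 12) + 4)), fun {n} G x s hs => ?_⟩
  let F : ℕ → ℕ := fun i => if hi : i < n then f G x ⟨i, hi⟩ else 0
  have hF : ∑ v, f G x v = ∑ i ∈ Finset.range n, F i := by simp [Finset.sum_range, F]
  have hbody : ∀ s', s.AgreeUpTo j s' → s'.reg (j + 2) < n →
      Computes p (j + 2) (F (s'.reg (j + 2))) (time.eval n) s' := by
    intro s' hs' hi
    have hs₁ := hs.of_agreeUpTo hρ hs'
    have hstores : s'.Stores G (Fin.cons (j + 2) ρ) (Fin.cons ⟨_, hi⟩ x : Fin (k + 1) → Fin n) :=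
      ⟨hs₁.arr, hs₁.size, Fin.cases rfl hs₁.vertex⟩
    simpa [F, hi] using hp G _ s' hstores
  have hinit (r : ℕ) (s' : State) : Computes (.assign (r + 1) (.lit 0)) r 0 2 s' :=
    computes_assign (.lit 0) r s'
  simp only [Polynomial.eval_add, Polynomial.eval_mul, Polynomial.eval_ofNat, Polynomial.eval_X]
  refine (hinit j s).seq le_rfl fun s₁ hs₁ hacc => ?_
  refine (hinit (j + 1) s₁).seq j.le_succ fun s₂ hs₂ (hcount : s₂.reg (j + 2) = 0) => ?_
  have hloop := computes_sumLoop hs.size hbody n s₂ (hs₁.trans (hs₂.mono j.le_succ))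
    (by omega)
  simpa [hF, hcount, hs₂.reg (j + 1) le_rfl, hacc] using hloop

end PolyTimeComputable

namespace PolyTimeDecidable

variable {P Q : ∀ {n : ℕ}, SimpleGraph (Fin n) → (Fin k → Fin n) → Prop}

open Classical in
theorem congr (hP : PolyTimeDecidable P)
    (hPQ : ∀ {n : ℕ} (G : SimpleGraph (Fin n)) (x : Fin k → Fin n), P G x ↔ Q G x) :
    PolyTimeDecidable Q :=
  PolyTimeComputable.congr hP fun G x => if_congr (hPQ G x) rfl rfl

/-- The inner program finds the vertices of `x ∘ σ` where the outer one keeps those of `x`. -/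
theorem reindex {Q : ∀ {n : ℕ}, SimpleGraph (Fin n) → (Fin l → Fin n) → Prop}
    (hQ : PolyTimeDecidable Q) (σ : Fin l → Fin k) : PolyTimeDecidable fun G x => Q G (x ∘ σ) := by
  intro ρ j hρ
  obtain ⟨p, time, hp⟩ := hQ (ρ ∘ σ) j fun i => hρ _
  exact ⟨p, time, fun G x s hs => hp G (x ∘ σ) s ⟨hs.arr, hs.size, fun i => hs.vertex _⟩⟩

theorem of_ne_zero {f : ∀ {n : ℕ}, SimpleGraph (Fin n) → (Fin k → Fin n) → ℕ}
    (hf : PolyTimeComputable f) : PolyTimeDecidable fun G x => f G x ≠ 0 :=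
  ((PolyTimeComputable.const 1).sub ((PolyTimeComputable.const 1).sub hf)).congr fun G x => by
    split_ifs <;> omega

theorem not (hP : PolyTimeDecidable P) : PolyTimeDecidable fun G x => ¬ P G x :=
  (of_ne_zero ((PolyTimeComputable.const 1).sub hP)).congr fun G x => by split_ifs <;> simp [*]

theorem or (hP : PolyTimeDecidable P) (hQ : PolyTimeDecidable Q) :
    PolyTimeDecidable fun G x => P G x ∨ Q G x :=
  (of_ne_zero (PolyTimeComputable.add hP hQ)).congr fun G x => by simp [imp_iff_not_or]

theorem and (hP : PolyTimeDecidable P) (hQ : PolyTimeDecidable Q) :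
    PolyTimeDecidable fun G x => P G x ∧ Q G x :=
  (hP.not.or hQ.not).not.congr fun G x => by tauto

theorem imp (hP : PolyTimeDecidable P) (hQ : PolyTimeDecidable Q) :
    PolyTimeDecidable fun G x => P G x → Q G x :=
  (hP.not.or hQ).congr fun _ _ => imp_iff_not_or.symm

theorem le {f g : ∀ {n : ℕ}, SimpleGraph (Fin n) → (Fin k → Fin n) → ℕ}
    (hf : PolyTimeComputable f) (hg : PolyTimeComputable g) :
    PolyTimeDecidable fun G x => f G x ≤ g G x :=
  (of_ne_zero (hf.sub hg)).not.congr fun G x => by omega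

theorem lt {f g : ∀ {n : ℕ}, SimpleGraph (Fin n) → (Fin k → Fin n) → ℕ}
    (hf : PolyTimeComputable f) (hg : PolyTimeComputable g) :
    PolyTimeDecidable fun G x => f G x < g G x :=
  (le hg hf).not.congr fun _ _ => not_le

theorem eq (i j : Fin k) : PolyTimeDecidable fun _ x => x i = x j :=
  ((le (.vertex i) (.vertex j)).and (le (.vertex j) (.vertex i))).congr fun _ x => by
    rw [← le_antisymm_iff, Fin.val_inj]

end PolyTimeDecidable

open Classical in
theorem PolyTimeComputable.ncard
    {P : ∀ {n : ℕ}, SimpleGraph (Fin n) → (Fin k → Fin n) → Fin n → Prop}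
    (hP : PolyTimeDecidable fun G (x : Fin (k + 1) → _) => P G (Fin.tail x) (x 0)) :
    PolyTimeComputable fun G x => {v | P G x v}.ncard :=
  (sum (f := fun G x v => if P G x v then 1 else 0) hP).congr fun G x => by
    rw [Set.ncard_eq_toFinset_card', Set.toFinset_ofPred, Finset.card_filter]

open Classical in
theorem inputState_arr_zero {n : ℕ} (G : SimpleGraph (Fin n)) (i j : Fin n) :
    (inputState G).arr 0 (n * i + j) = if G.Adj i j then 1 else 0 := by
  refine if_congr ⟨?_, fun h => ⟨rfl, i, j, h, by rw [mul_comm]⟩⟩ rfl rfl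
  rintro ⟨-, i', j', hadj, heq⟩
  have : finProdFinEquiv (i, j) = finProdFinEquiv (i', j') := Fin.ext <| by
    simpa only [finProdFinEquiv_apply_val, add_comm, mul_comm] using heq
  obtain ⟨rfl, rfl⟩ := Prod.ext_iff.1 (finProdFinEquiv.injective this)
  exact hadj

namespace PolyTimeDecidable

section Quantifiers

variable {P : ∀ {n : ℕ}, SimpleGraph (Fin n) → (Fin k → Fin n) → Fin n → Prop}

theorem exists_vertex
    (hP : PolyTimeDecidable fun G (x : Fin (k + 1) → _) => P G (Fin.tail x) (x 0)) :
    PolyTimeDecidable fun G x => ∃ v, P G x v :=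
  (of_ne_zero (PolyTimeComputable.ncard hP)).congr fun _ _ =>
    Nat.pos_iff_ne_zero.symm.trans Set.ncard_pos

theorem forall_vertex
    (hP : PolyTimeDecidable fun G (x : Fin (k + 1) → _) => P G (Fin.tail x) (x 0)) :
    PolyTimeDecidable fun G x => ∀ v, P G x v :=
  (exists_vertex (P := fun G x v => ¬ P G x v) hP.not).not.congr fun _ _ => not_exists_not

end Quantifiers

/-- The machine cannot multiply, so the row offset `n * x i` is computed as a sum. -/
theorem adj (i j : Fin k) : PolyTimeDecidable fun G x => G.Adj (x i) (x j) :=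
  ((PolyTimeComputable.sum (f := fun _ x _ => x i) (.vertex i.succ)).add
    (.vertex j)).cell.congr fun G x => by
      rw [Fin.sum_const, smul_eq_mul, inputState_arr_zero]

theorem polyTimeSolvableOn {C P Q : ∀ {n : ℕ}, SimpleGraph (Fin n) → Prop}
    (hQ : PolyTimeDecidable (k := 0) fun G _ => Q G)
    (hPQ : ∀ {n : ℕ} (G : SimpleGraph (Fin n)), C G → (P G ↔ Q G)) :
    PolyTimeSolvableOn C P := by
  obtain ⟨p, time, hp⟩ := hQ Fin.elim0 0 Fin.rec0
  refine ⟨.seq p (.assign 0 (.reg 1)), time + 2, fun n G hG => ?_⟩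
  have hinput : (inputState G).Stores G Fin.elim0 Fin.elim0 := ⟨rfl, rfl, Fin.rec0⟩
  obtain ⟨s, t, hexec, ht, -, hs⟩ := hp G Fin.elim0 (inputState G) hinput
  refine ⟨_, _, .seq hexec (.assign 0 (.reg 1) s), ?_, ?_⟩
  · simpa [Expr.cost] using ht
  · simp [State.setReg, Expr.eval, hs, hPQ G hG]

end PolyTimeDecidable

end PolyTime

/-! ### The boundary of the set of dense vertices -/

section Tight

variable {V : Type*} [Fintype V] {G : SimpleGraph V} {d e v : V}

open Classical in
theorem degree_eq_ncard_neighborSet (G : SimpleGraph V) (v : V) :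
    G.degree v = (G.neighborSet v).ncard := by
  rw [Set.ncard_eq_toFinset_card', Set.toFinset_card, SimpleGraph.card_neighborSet_eq_degree]

theorem isDense_iff_mDegree_le : IsDense G v ↔ mDegree G ≤ (G.neighborSet v).ncard + 1 := by
  rw [IsDense, degree_eq_ncard_neighborSet]

theorem IsTight.ncard_isDense (hG : IsTight G) : {v | IsDense G v}.ncard = mDegree G := by
  classical rw [← hG.1, Set.ncard_eq_toFinset_card', Set.toFinset_ofPred]

theorem IsTight.ncard_neighborSet (hG : IsTight G) (hv : IsDense G v) :
    (G.neighborSet v).ncard + 1 = mDegree G := by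
  rw [← degree_eq_ncard_neighborSet, hG.2 v hv]

variable (G)

/-- The dense neighbours of `v`. -/
def denseNeighborSet (v : V) : Set V := {w | IsDense G w ∧ G.Adj v w}

/-- The dense vertices that are distinct from `v` and not adjacent to it. In a tight b-colouring of
a tight graph the dense vertices have distinct colours, and these are the ones whose colours a
dense vertex `v` has to see on its other neighbours. -/
def denseNonneighborSet (v : V) : Set V := {w | IsDense G w ∧ Gᶜ.Adj v w}

/-- The neighbours of `v` that are not dense. -/
def nondenseNeighborSet (v : V) : Set V := {w | ¬ IsDense G w ∧ G.Adj v w}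

/-- The boundary of the set of dense vertices: the other vertices with a dense neighbour. -/
def boundary : Set V := {v | ¬ IsDense G v ∧ (denseNeighborSet G v).Nonempty}

variable {G}

theorem mem_boundary_of_mem_nondenseNeighborSet (he : IsDense G e)
    (hv : v ∈ nondenseNeighborSet G e) : v ∈ boundary G :=
  ⟨hv.1, e, he, hv.2.symm⟩

theorem mem_denseNonneighborSet_comm (hd : IsDense G d) (he : IsDense G e) :
    d ∈ denseNonneighborSet G e ↔ e ∈ denseNonneighborSet G d := by
  simp only [denseNonneighborSet, Set.mem_ofPred, hd, he, true_and, Gᶜ.adj_comm]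

theorem IsTight.ncard_nondenseNeighborSet (hG : IsTight G) (he : IsDense G e) :
    (nondenseNeighborSet G e).ncard = (denseNonneighborSet G e).ncard := by
  have hneighbors : G.neighborSet e = denseNeighborSet G e ∪ nondenseNeighborSet G e := by
    ext v
    simp only [denseNeighborSet, nondenseNeighborSet, SimpleGraph.mem_neighborSet, Set.mem_union,
      Set.mem_ofPred]
    tauto
  have hdense : {v | IsDense G v} =
      insert e (denseNeighborSet G e ∪ denseNonneighborSet G e) := by
    ext v
    simp only [denseNeighborSet, denseNonneighborSet, SimpleGraph.compl_adj, Set.mem_union,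
      Set.mem_insert_iff, Set.mem_ofPred]
    by_cases hve : v = e
    · simp [hve, he]
    · have := Ne.symm hve
      tauto
  have hdisj : Disjoint (denseNeighborSet G e) (nondenseNeighborSet G e) :=
    Set.disjoint_left.2 fun _ h h' => h'.1 h.1
  have hdisj' : Disjoint (denseNeighborSet G e) (denseNonneighborSet G e) :=
    Set.disjoint_left.2 fun _ h h' => h'.2.2 h.2
  have hnotMem : e ∉ denseNeighborSet G e ∪ denseNonneighborSet G e := by
    simp [denseNeighborSet, denseNonneighborSet]
  have h₁ := hG.ncard_neighborSet he
  have h₂ := hG.ncard_isDense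
  rw [hneighbors, Set.ncard_union_eq hdisj] at h₁
  rw [hdense, Set.ncard_insert_of_notMem hnotMem, Set.ncard_union_eq hdisj'] at h₂
  omega

end Tight

open SimpleGraph in
theorem twoP2AddP1_eq_of_adj_iff {i j : (Fin 2 ⊕ Fin 2) ⊕ Fin 1}
    (h : ∀ k, twoP2AddP1.Adj i k ↔ twoP2AddP1.Adj j k) : i = j := by
  revert i j
  simp [twoP2AddP1, pathGraph_adj, Sum.forall, Fin.forall_fin_two]

open SimpleGraph in
theorem IsFreeOf.adj_of_twoP2 {V : Type*} {G : SimpleGraph V} (hfree : IsFreeOf twoP2AddP1 G)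
    {a b c d : V} (hab : G.Adj a b) (hcd : G.Adj c d) (hac : ¬ G.Adj a c) (had : ¬ G.Adj a d)
    (hbc : ¬ G.Adj b c) (hbd : ¬ G.Adj b d) (e : V) :
    G.Adj e a ∨ G.Adj e b ∨ G.Adj e c ∨ G.Adj e d := by
  by_contra! he
  simp only [G.adj_comm e] at he
  obtain ⟨hae, hbe, hce, hde⟩ := he
  let f : (Fin 2 ⊕ Fin 2) ⊕ Fin 1 → V := Sum.elim (Sum.elim ![a, b] ![c, d]) fun _ => e
  have hf (i j) : G.Adj (f i) (f j) ↔ twoP2AddP1.Adj i j := by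
    rcases i with (i | i) | i <;> rcases j with (j | j) | j <;> fin_cases i <;> fin_cases j <;>
      simp [f, twoP2AddP1, pathGraph_adj, G.adj_comm, *]
  have hinj : f.Injective := fun i j hij =>
    twoP2AddP1_eq_of_adj_iff fun k => by rw [← hf, hij, hf]
  exact hfree ⟨⟨f, hinj⟩, hf _ _⟩

section Colouring

variable {V : Type*} {G : SimpleGraph V}

theorem exists_coloring_eqOn_mapsTo {α : Type*} [Finite V] {S : Set V} {C : Set α} (κ : V → α)
    (hκ : ∀ u ∈ S, ∀ v ∈ S, G.Adj u v → κ u ≠ κ v)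
    (hC : ∀ v ∉ S, (G.neighborSet v).ncard < C.ncard) :
    ∃ c : G.Coloring α, Set.EqOn c κ S ∧ Set.MapsTo c Sᶜ C := by
  classical
  suffices h : ∀ T ⊆ Sᶜ, ∃ f : V → α, Set.EqOn f κ S ∧ Set.MapsTo f T C ∧
      ∀ u ∈ S ∪ T, ∀ v ∈ S ∪ T, G.Adj u v → f u ≠ f v by
    obtain ⟨f, hfS, hfC, hf⟩ := h Sᶜ subset_rfl
    rw [Set.union_compl_self] at hf
    exact ⟨SimpleGraph.Coloring.mk f fun {u v} huv => hf u trivial v trivial huv, hfS, hfC⟩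
  intro T hT
  induction T, T.toFinite using Set.Finite.induction_on with
  | empty => exact ⟨κ, Set.eqOn_refl κ S, Set.mapsTo_empty κ C, by simpa using hκ⟩
  | @insert a T haT _ ih =>
    rw [Set.insert_subset_iff] at hT
    obtain ⟨f, hfS, hfC, hf⟩ := ih hT.2
    have haS : a ∉ S := hT.1
    obtain ⟨x, hxC, hx⟩ := Set.exists_mem_notMem_of_ncard_lt_ncard
      ((Set.ncard_image_le (f := f)).trans_lt (hC a haS))
    have hfx (v : V) (hav : G.Adj a v) : x ≠ f v := fun h => hx ⟨v, hav, h.symm⟩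
    have hother {v : V} (hva : v ≠ a) : Function.update f a x v = f v :=
      Function.update_of_ne hva x f
    refine ⟨Function.update f a x, fun v hv => ?_, ?_, ?_⟩
    · rw [hother (ne_of_mem_of_not_mem hv haS), hfS hv]
    · rintro v (rfl | hv)
      · rwa [Function.update_self]
      · rw [hother (ne_of_mem_of_not_mem hv haT)]
        exact hfC hv
    · intro u hu v hv huv
      rw [Set.union_insert] at hu hv
      obtain rfl | hua := eq_or_ne u a
      · rw [Function.update_self, hother huv.ne']
        exact hfx v huv
      obtain rfl | hva := eq_or_ne v a
      · rw [Function.update_self, hother hua]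
        exact (hfx u huv.symm).symm
      rw [hother hua, hother hva]
      exact hf u (hu.resolve_left hua) v (hv.resolve_left hva) huv

end Colouring

/-! ### Tight b-colourings seen from the boundary -/

section BoundaryColouring

variable {V : Type*} [Fintype V]

/-- A tight b-colouring seen from the boundary: colours are named after the dense vertices, and
`κ v` is the colour of the boundary vertex `v`. The values of `κ` off the boundary are
irrelevant. -/
structure IsBoundaryColouring (G : SimpleGraph V) (κ : V → V) : Prop where
  isDense {v : V} : v ∈ boundary G → IsDense G (κ v)
  subset {v : V} : v ∈ boundary G → denseNeighborSet G v ⊆ denseNonneighborSet G (κ v)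
  not_adj {u v : V} : u ∈ boundary G → v ∈ boundary G → κ u = κ v → ¬ G.Adj u v
  exists_adj {d e : V} : IsDense G e → d ∈ denseNonneighborSet G e →
    ∃ v ∈ boundary G, G.Adj v e ∧ κ v = d

variable {G : SimpleGraph V} {κ : V → V} {c : G.Coloring ℕ+} {v : V}

theorem IsTightBColouring.isDense_of_isBChromaticVertex (hc : IsTightBColouring c)
    (hv : IsBChromaticVertex c v) : IsDense G v := by
  have hsub : Set.range c ⊆ insert (c v) (c '' G.neighborSet v) := fun j hj =>
    or_iff_not_imp_left.2 fun hjv => hv j hj hjv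
  rw [isDense_iff_mDegree_le, ← hc.2]
  calc (Set.range c).ncard ≤ (insert (c v) (c '' G.neighborSet v)).ncard :=
        Set.ncard_le_ncard hsub
    _ ≤ (c '' G.neighborSet v).ncard + 1 := Set.ncard_insert_le _ _
    _ ≤ (G.neighborSet v).ncard + 1 := Nat.add_le_add_right Set.ncard_image_le 1

theorem IsTightBColouring.exists_isDense (hc : IsTightBColouring c) (v : V) :
    ∃ d, IsDense G d ∧ c d = c v ∧ IsBChromaticVertex c d :=
  have ⟨d, hdv, hd⟩ := hc.1 (c v) ⟨v, rfl⟩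
  ⟨d, hc.isDense_of_isBChromaticVertex hd, hdv, hd⟩

theorem IsTightBColouring.injOn_isDense (hc : IsTightBColouring c) (hG : IsTight G) :
    Set.InjOn c {v | IsDense G v} := by
  have himage : c '' {v | IsDense G v} = Set.range c := by
    refine (Set.image_subset_range _ _).antisymm ?_
    rintro _ ⟨v, rfl⟩
    obtain ⟨d, hd, hdv, -⟩ := hc.exists_isDense v
    exact ⟨d, hd, hdv⟩
  rw [← Set.ncard_image_iff, himage, hc.2, hG.ncard_isDense]

theorem IsTightBColouring.isBChromaticVertex (hc : IsTightBColouring c) (hG : IsTight G)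
    (hv : IsDense G v) : IsBChromaticVertex c v := by
  obtain ⟨d, hd, hdv, hbd⟩ := hc.exists_isDense v
  rwa [hc.injOn_isDense hG hd hv hdv] at hbd

theorem IsTightBColouring.injOn_neighborSet (hc : IsTightBColouring c) (hG : IsTight G)
    (hv : IsDense G v) : Set.InjOn c (G.neighborSet v) := by
  have himage : insert (c v) (c '' G.neighborSet v) = Set.range c := by
    refine Set.Subset.antisymm (Set.insert_subset ⟨v, rfl⟩ (Set.image_subset_range _ _)) ?_
    exact fun j hj => or_iff_not_imp_left.2 fun hjv => hc.isBChromaticVertex hG hv j hj hjv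
  have hnotMem : c v ∉ c '' G.neighborSet v := by
    rintro ⟨w, hw, hwv⟩
    exact c.valid hw hwv.symm
  rw [← Set.ncard_image_iff, ← Nat.add_right_cancel_iff (n := 1),
    ← Set.ncard_insert_of_notMem hnotMem, himage, hc.2, hG.ncard_neighborSet hv]

theorem IsTightBColouring.exists_isBoundaryColouring (hc : IsTightBColouring c)
    (hG : IsTight G) : ∃ κ, IsBoundaryColouring G κ := by
  choose κ hκ hcκ _ using hc.exists_isDense
  refine ⟨κ, ⟨fun _ => hκ _, fun {v} hv w hw => ?_, fun {u v} _ _ huv hadj => ?_,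
    fun {d e} he hd => ?_⟩⟩
  · refine ⟨hw.1, (SimpleGraph.compl_adj _ _ _).2 ⟨?_, fun hadj => hv.1 ?_⟩⟩
    · rintro rfl
      exact c.valid hw.2 (hcκ v).symm
    · rw [← hc.injOn_neighborSet hG hw.1 hadj.symm hw.2.symm (hcκ v)]
      exact hκ v
  · exact c.valid hadj (by rw [← hcκ u, huv, hcκ v])
  · have hne : c d ≠ c e := fun h => hd.2.ne (hc.injOn_isDense hG hd.1 he h).symm
    obtain ⟨v, hev, hvd⟩ := hc.isBChromaticVertex hG he (c d) ⟨d, rfl⟩ hne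
    have hv : ¬ IsDense G v := fun hv => hd.2.2 (hc.injOn_isDense hG hv hd.1 hvd ▸ hev)
    exact ⟨v, mem_boundary_of_mem_nondenseNeighborSet he ⟨hv, hev⟩, hev.symm,
      hc.injOn_isDense hG (hκ v) hd.1 ((hcκ v).trans hvd)⟩

/-- The dense vertices get their own colours, the boundary is coloured by `κ`, and the remaining
vertices have too few neighbours to obstruct a greedy extension. -/
theorem IsBoundaryColouring.exists_coloring (hκ : IsBoundaryColouring G κ) (hG : IsTight G) :
    ∃ c : G.Coloring V, (∀ v, IsDense G v → c v = v) ∧ Set.EqOn c κ (boundary G) ∧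
      ∀ v, IsDense G (c v) := by
  classical
  let κ' : V → V := fun v => if IsDense G v then v else κ v
  have hdense {v : V} (hv : IsDense G v) : κ' v = v := if_pos hv
  have hboundary {v : V} (hv : v ∈ boundary G) : κ' v = κ v := if_neg hv.1
  have hcross {u v : V} (hu : IsDense G u) (hv : v ∈ boundary G) (huv : G.Adj u v) :
      κ' u ≠ κ' v := by
    rw [hdense hu, hboundary hv]
    exact (hκ.subset hv ⟨hu, huv.symm⟩).2.ne'
  have hproper : ∀ u ∈ {v | IsDense G v} ∪ boundary G, ∀ v ∈ {v | IsDense G v} ∪ boundary G,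
      G.Adj u v → κ' u ≠ κ' v := by
    rintro u (hu | hu) v (hv | hv) huv
    · rw [hdense hu, hdense hv]
      exact huv.ne
    · exact hcross hu hv huv
    · exact (hcross hv hu huv.symm).symm
    · rw [hboundary hu, hboundary hv]
      exact fun h => hκ.not_adj hu hv h huv
  obtain ⟨c, hc, hrest⟩ := exists_coloring_eqOn_mapsTo (C := {v | IsDense G v}) κ' hproper
    fun v hv => by
      have := mt isDense_iff_mDegree_le.2 fun h => hv (.inl h)
      rw [hG.ncard_isDense]
      omega
  have hcd (v : V) (hv : IsDense G v) : c v = v := (hc (.inl hv)).trans (hdense hv)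
  have hcb : Set.EqOn c κ (boundary G) := fun v hv => (hc (.inr hv)).trans (hboundary hv)
  refine ⟨c, hcd, hcb, fun v => ?_⟩
  by_cases hv : v ∈ {v | IsDense G v} ∪ boundary G
  · rcases hv with hv | hv
    · exact (hcd v hv).symm ▸ hv
    · exact (hcb hv).symm ▸ hκ.isDense hv
  · exact hrest hv

theorem IsBoundaryColouring.hasTightBColouring (hκ : IsBoundaryColouring G κ) (hG : IsTight G) :
    HasTightBColouring G := by
  obtain ⟨c, hdense, hboundary, hrange⟩ := hκ.exists_coloring hG
  let f : V ↪ ℕ+ := (Fintype.equivFin V).toEmbedding.trans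
    (Fin.valEmbedding.trans Equiv.pnatEquivNat.symm.toEmbedding)
  have hcolour (v : V) : G.recolorOfEmbedding f c v = f (c v) := rfl
  refine ⟨G.recolorOfEmbedding f c, ?_, ?_⟩
  · rintro _ ⟨v, rfl⟩
    refine ⟨c v, by rw [hcolour, hdense _ (hrange v), hcolour], ?_⟩
    rintro _ ⟨w, rfl⟩ hne
    simp only [hcolour, f.injective.ne_iff, hdense _ (hrange v)] at hne ⊢
    by_cases hadj : G.Adj (c v) (c w)
    · exact ⟨c w, hadj, by rw [hdense _ (hrange w)]⟩
    · obtain ⟨x, hx, hxadj, hxw⟩ := hκ.exists_adj (hrange v) ⟨hrange w, hne.symm, hadj⟩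
      exact ⟨x, hxadj.symm, by rw [hboundary hx, hxw]⟩
  · have hcd : Set.range c = {v | IsDense G v} :=
      Set.Subset.antisymm (Set.range_subset_iff.2 hrange) fun v hv => ⟨v, hdense v hv⟩
    have hrec : Set.range (G.recolorOfEmbedding f c) = f '' Set.range c := Set.range_comp f c
    rw [hrec, Set.ncard_image_of_injective _ f.injective, hcd, hG.ncard_isDense]

theorem IsTight.hasTightBColouring_iff_isBoundaryColouring (hG : IsTight G) :
    HasTightBColouring G ↔ ∃ κ, IsBoundaryColouring G κ :=
  ⟨fun ⟨_, hc⟩ => hc.exists_isBoundaryColouring hG, fun ⟨_, hκ⟩ => hκ.hasTightBColouring hG⟩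

end BoundaryColouring

/-! ### Colourings with prescribed repeated colours -/

section Assignment

variable {V : Type*} [Fintype V]

/-- The boundary vertices that a colour `d ∈ X` is able to take over. In the criterion, `X` holds
the only colour (if any) that appears on several boundary vertices, and these are the vertices of
that colour. -/
def residue (G : SimpleGraph V) (X : Set V) : Set V :=
  {v ∈ boundary G | ∃ d ∈ X, denseNeighborSet G v ⊆ denseNonneighborSet G d}

/-- The colours outside `X` that are missing at some dense vertex; each of them has to appear on
exactly one boundary vertex. -/
def demand (G : SimpleGraph V) (X : Set V) : Set V :=
  {e | IsDense G e ∧ e ∉ X ∧ (denseNonneighborSet G e).Nonempty}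

/-- `φ e` is the boundary vertex of colour `e`, for every `e ∈ demand G X`. It has to see exactly
the dense vertices at which the colour `e` is missing. -/
structure IsAssignment (G : SimpleGraph V) (X : Set V) (φ : V → V) : Prop where
  mapsTo : Set.MapsTo φ (demand G X) (boundary G \ residue G X)
  injOn : Set.InjOn φ (demand G X)
  denseNeighborSet_eq {e : V} : e ∈ demand G X →
    denseNeighborSet G (φ e) = denseNonneighborSet G e

/-- The boundary can be coloured such that only colours in `X` are repeated. -/
def IsAdmissible (G : SimpleGraph V) (X : Set V) : Prop :=
  G.IsIndepSet (residue G X) ∧ ∃ φ, IsAssignment G X φ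

variable {G : SimpleGraph V} {X : Set V} {φ κ : V → V} {d e v : V}

namespace IsAssignment

theorem mem_nondenseNeighborSet (hφ : IsAssignment G X φ) (he : e ∈ demand G X)
    (hd : d ∈ denseNonneighborSet G e) : φ e ∈ nondenseNeighborSet G d := by
  rw [← hφ.denseNeighborSet_eq he] at hd
  exact ⟨(hφ.mapsTo he).1.1, hd.2.symm⟩

theorem image_demand_inter_nondenseNeighborSet_subset (hφ : IsAssignment G X φ)
    (he : IsDense G e) :
    φ '' demand G X ∩ nondenseNeighborSet G e ⊆ φ '' (denseNonneighborSet G e \ X) := by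
  rintro _ ⟨⟨d, hd, rfl⟩, hde⟩
  have hmem : e ∈ denseNonneighborSet G d := by
    rw [← hφ.denseNeighborSet_eq hd]
    exact ⟨he, hde.2.symm⟩
  exact ⟨d, ⟨(mem_denseNonneighborSet_comm hd.1 he).2 hmem, hd.2.1⟩, rfl⟩

/-- If no colour missing at `e` were in `X`, then `φ` would map the missing colours bijectively onto
the non-dense neighbours of `e`. -/
theorem exists_mem_of_notMem_image (hφ : IsAssignment G X φ) (hG : IsTight G) (he : IsDense G e)
    (hve : v ∈ nondenseNeighborSet G e) (hv : v ∉ φ '' demand G X) :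
    ∃ d ∈ X, e ∈ denseNonneighborSet G d := by
  by_contra! hX
  have hsub : denseNonneighborSet G e ⊆ demand G X := fun d hd =>
    have hde := (mem_denseNonneighborSet_comm hd.1 he).1 hd
    ⟨hd.1, fun hdX => hX d hdX hde, e, hde⟩
  have himage : φ '' denseNonneighborSet G e ⊆ nondenseNeighborSet G e := by
    rintro _ ⟨d, hd, rfl⟩
    exact hφ.mem_nondenseNeighborSet (hsub hd) ((mem_denseNonneighborSet_comm hd.1 he).1 hd)
  have heq := Set.eq_of_subset_of_ncard_le himage <| by
    rw [(hφ.injOn.mono hsub).ncard_image, hG.ncard_nondenseNeighborSet he]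
  exact hv (Set.image_mono hsub (heq ▸ hve))

theorem mem_residue_of_notMem_image (hφ : IsAssignment G X φ) (hG : IsTight G)
    (hX : X.Subsingleton) (hv : v ∈ boundary G) (hvφ : v ∉ φ '' demand G X) :
    v ∈ residue G X := by
  obtain ⟨e, he, hve⟩ := hv.2
  obtain ⟨d, hdX, -⟩ := hφ.exists_mem_of_notMem_image hG he ⟨hv.1, hve.symm⟩ hvφ
  refine ⟨hv, d, hdX, fun a ha => ?_⟩
  obtain ⟨d', hdX', had'⟩ := hφ.exists_mem_of_notMem_image hG ha.1 ⟨hv.1, ha.2.symm⟩ hvφ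
  rwa [hX hdX hdX']

/-- The colour `d` missing at `e` leaves too few assigned vertices to exhaust the non-dense
neighbours of `e`. -/
theorem exists_notMem_image (hφ : IsAssignment G X φ) (hG : IsTight G) (hd : d ∈ X)
    (he : IsDense G e) (hde : d ∈ denseNonneighborSet G e) :
    ∃ v ∈ nondenseNeighborSet G e, v ∉ φ '' demand G X := by
  by_contra! hall
  have hsub : nondenseNeighborSet G e ⊆ φ '' (denseNonneighborSet G e \ X) := fun v hv =>
    hφ.image_demand_inter_nondenseNeighborSet_subset he ⟨hall v hv, hv⟩
  have hlt : (denseNonneighborSet G e \ X).ncard < (denseNonneighborSet G e).ncard :=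
    Set.ncard_lt_ncard ⟨Set.sdiff_subset, fun h => (h hde).2 hd⟩
  have hle := (Set.ncard_le_ncard hsub).trans Set.ncard_image_le
  rw [hG.ncard_nondenseNeighborSet he] at hle
  omega

theorem exists_colour (hφ : IsAssignment G X φ) (hG : IsTight G) (hX : X.Subsingleton) (v : V) :
    ∃ d, v ∈ boundary G → d ∈ demand G X ∧ φ d = v ∨
      v ∈ residue G X ∧ d ∈ X ∧ denseNeighborSet G v ⊆ denseNonneighborSet G d := by
  by_cases hv : ∃ e ∈ demand G X, φ e = v
  · obtain ⟨e, he, hev⟩ := hv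
    exact ⟨e, fun _ => .inl ⟨he, hev⟩⟩
  by_cases hvb : v ∈ boundary G
  · have hres := hφ.mem_residue_of_notMem_image hG hX hvb hv
    obtain ⟨d, hdX, hd⟩ := hres.2
    exact ⟨d, fun _ => .inr ⟨hres, hdX, hd⟩⟩
  · exact ⟨v, fun h => absurd h hvb⟩

theorem exists_isBoundaryColouring (hφ : IsAssignment G X φ) (hG : IsTight G)
    (hXdense : X ⊆ {v | IsDense G v}) (hX : X.Subsingleton)
    (hindep : G.IsIndepSet (residue G X)) : ∃ κ, IsBoundaryColouring G κ := by
  choose κ hκ using hφ.exists_colour hG hX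
  refine ⟨κ, fun {v} hv => ?_, fun {v} hv => ?_, fun {u v} hu hv huv hadj => ?_,
    fun {d e} he hd => ?_⟩
  · rcases hκ v hv with h | h
    · exact h.1.1
    · exact hXdense h.2.1
  · rcases hκ v hv with ⟨hdem, hφv⟩ | h
    · rw [← hφ.denseNeighborSet_eq hdem, hφv]
    · exact h.2.2
  · rcases hκ u hu with ⟨hdu, hφu⟩ | ⟨hru, hXu, -⟩ <;>
      rcases hκ v hv with ⟨hdv, hφv⟩ | ⟨hrv, hXv, -⟩
    · exact hadj.ne (by rw [← hφu, ← hφv, huv])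
    · exact hdu.2.1 (huv ▸ hXv)
    · exact hdv.2.1 (huv ▸ hXu)
    · exact hindep hru hrv hadj.ne hadj
  · have hed := (mem_denseNonneighborSet_comm hd.1 he).1 hd
    by_cases hdX : d ∈ X
    · obtain ⟨v, hve, hv⟩ := hφ.exists_notMem_image hG hdX he hd
      have hvb := mem_boundary_of_mem_nondenseNeighborSet he hve
      refine ⟨v, hvb, hve.2.symm, ?_⟩
      rcases hκ v hvb with ⟨hdv, hφv⟩ | ⟨-, hXv, -⟩
      · exact absurd ⟨κ v, hdv, hφv⟩ hv
      · exact hX hXv hdX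
    · have hddem : d ∈ demand G X := ⟨hd.1, hdX, e, hed⟩
      have hvb := (hφ.mapsTo hddem).1
      refine ⟨φ d, hvb, (hφ.mem_nondenseNeighborSet hddem hed).2.symm, ?_⟩
      rcases hκ _ hvb with ⟨hdv, hφv⟩ | h
      · exact hφ.injOn hdv hddem hφv
      · exact absurd h.1 (hφ.mapsTo hddem).2

end IsAssignment

end Assignment

/-! ### Repeated colours in `(2P₂ + P₁)`-free graphs -/

section RepeatedColours

variable {V : Type*} [Fintype V]

/-- The boundary vertices of colour `d`. -/
def colourClass (G : SimpleGraph V) (κ : V → V) (d : V) : Set V := {v ∈ boundary G | κ v = d}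

/-- The colours that appear on at least two boundary vertices. -/
def repeatedColours (G : SimpleGraph V) (κ : V → V) : Set V :=
  {d | (colourClass G κ d).Nontrivial}

namespace IsBoundaryColouring

variable {G : SimpleGraph V} {κ : V → V} {a d e e' f s s' u v : V}

theorem isDense_of_mem_colourClass (hκ : IsBoundaryColouring G κ) (hs : s ∈ colourClass G κ d) :
    IsDense G d :=
  hs.2 ▸ hκ.isDense hs.1

theorem isDense_of_mem_repeatedColours (hκ : IsBoundaryColouring G κ)
    (hd : d ∈ repeatedColours G κ) : IsDense G d :=
  have ⟨_, hs⟩ := hd.nonempty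
  hκ.isDense_of_mem_colourClass hs

theorem mem_denseNonneighborSet (hκ : IsBoundaryColouring G κ) (hs : s ∈ colourClass G κ d)
    (he : e ∈ denseNeighborSet G s) : e ∈ denseNonneighborSet G d :=
  hs.2 ▸ hκ.subset hs.1 he

theorem exists_mem_colourClass (hκ : IsBoundaryColouring G κ) (hd : IsDense G d)
    (he : e ∈ denseNonneighborSet G d) :
    ∃ s ∈ colourClass G κ d, e ∈ denseNeighborSet G s :=
  have ⟨s, hs, hse, hsd⟩ := hκ.exists_adj he.1 ((mem_denseNonneighborSet_comm hd he.1).2 he)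
  ⟨s, ⟨hs, hsd⟩, he.1, hse⟩

theorem not_adj_of_adj_colour (hκ : IsBoundaryColouring G κ) (hs : s ∈ colourClass G κ d)
    (he : IsDense G e) (hde : G.Adj d e) : ¬ G.Adj s e := fun hse =>
  (hκ.mem_denseNonneighborSet hs ⟨he, hse⟩).2.2 hde

theorem not_adj_colour (hκ : IsBoundaryColouring G κ) (hs : s ∈ colourClass G κ d) :
    ¬ G.Adj s d := fun hsd =>
  (hκ.mem_denseNonneighborSet hs ⟨hκ.isDense_of_mem_colourClass hs, hsd⟩).2.ne rfl

theorem not_adj_of_mem_colourClass (hκ : IsBoundaryColouring G κ) (hs : s ∈ colourClass G κ d)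
    (hs' : s' ∈ colourClass G κ d) : ¬ G.Adj s s' :=
  hκ.not_adj hs.1 hs'.1 (hs.2.trans hs'.2.symm)

/-- A dense vertex has exactly as many non-dense neighbours as colours missing among its dense
ones. -/
theorem injOn_nondenseNeighborSet (hκ : IsBoundaryColouring G κ) (hG : IsTight G)
    (he : IsDense G e) : Set.InjOn κ (nondenseNeighborSet G e) := by
  have hsub : denseNonneighborSet G e ⊆ κ '' nondenseNeighborSet G e := fun d hd =>
    have ⟨s, hs, hse, hsd⟩ := hκ.exists_adj he hd
    ⟨s, ⟨hs.1, hse.symm⟩, hsd⟩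
  refine Set.injOn_of_ncard_image_eq (le_antisymm Set.ncard_image_le ?_)
  rw [hG.ncard_nondenseNeighborSet he]
  exact Set.ncard_le_ncard hsub

theorem not_adj_of_ne (hκ : IsBoundaryColouring G κ) (hG : IsTight G)
    (hs : s ∈ colourClass G κ d) (hs' : s' ∈ colourClass G κ d) (hne : s ≠ s')
    (he : e ∈ denseNeighborSet G s) : ¬ G.Adj s' e := fun hs'e =>
  hne <| hκ.injOn_nondenseNeighborSet hG he.1 ⟨hs.1.1, he.2.symm⟩ ⟨hs'.1.1, hs'e.symm⟩
    (hs.2.trans hs'.2.symm)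

theorem adj_of_ne (hκ : IsBoundaryColouring G κ) (hG : IsTight G)
    (hfree : IsFreeOf twoP2AddP1 G) (hs : s ∈ colourClass G κ d) (hs' : s' ∈ colourClass G κ d)
    (hne : s ≠ s') (he : e ∈ denseNeighborSet G s) (he' : e' ∈ denseNeighborSet G s') :
    G.Adj e e' := by
  by_contra hee'
  have hse' := hκ.not_adj_of_ne hG hs' hs hne.symm he'
  have hs'e := hκ.not_adj_of_ne hG hs hs' hne he
  rcases hfree.adj_of_twoP2 he.2 he'.2 (hκ.not_adj_of_mem_colourClass hs hs') hse'
    (fun h => hs'e h.symm) hee' d with h | h | h | h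
  · exact hκ.not_adj_colour hs h.symm
  · exact (hκ.mem_denseNonneighborSet hs he).2.2 h
  · exact hκ.not_adj_colour hs' h.symm
  · exact (hκ.mem_denseNonneighborSet hs' he').2.2 h

theorem exists_ne_mem_colourClass (hκ : IsBoundaryColouring G κ) (hd : d ∈ repeatedColours G κ)
    (he : e ∈ denseNonneighborSet G d) : ∃ s ∈ colourClass G κ d, e ∈ denseNeighborSet G s ∧
      ∃ s' ∈ colourClass G κ d, s ≠ s' :=
  have ⟨s, hs, hse⟩ := hκ.exists_mem_colourClass (hκ.isDense_of_mem_repeatedColours hd) he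
  have ⟨s', hs', hne⟩ := hd.exists_ne s
  ⟨s, hs, hse, s', hs', hne.symm⟩

theorem adj_of_mem_repeatedColours (hκ : IsBoundaryColouring G κ) (hG : IsTight G)
    (hfree : IsFreeOf twoP2AddP1 G) (hd : d ∈ repeatedColours G κ) (hf : IsDense G f)
    (hdf : G.Adj d f) (he : e ∈ denseNonneighborSet G d) : G.Adj f e := by
  by_contra hfe
  obtain ⟨s, hs, hse, s', hs', hne⟩ := hκ.exists_ne_mem_colourClass hd he
  have hfs := hκ.not_adj_of_adj_colour hs hf hdf
  rcases hfree.adj_of_twoP2 hdf hse.2 (fun h => hκ.not_adj_colour hs h.symm) he.2.2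
    (fun h => hfs h.symm) hfe s' with h | h | h | h
  · exact hκ.not_adj_colour hs' h
  · exact hκ.not_adj_of_adj_colour hs' hf hdf h
  · exact hκ.not_adj_of_mem_colourClass hs' hs h
  · exact hκ.not_adj_of_ne hG hs hs' hne hse h

theorem notMem_denseNonneighborSet_of_mem_repeatedColours (hκ : IsBoundaryColouring G κ)
    (hG : IsTight G) (hfree : IsFreeOf twoP2AddP1 G) (hd : d ∈ repeatedColours G κ)
    (hf : f ∈ repeatedColours G κ) : f ∉ denseNonneighborSet G d := by
  intro hfd
  have hd' := hκ.isDense_of_mem_repeatedColours hd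
  obtain ⟨s, hs, hsf, s', hs', hne⟩ := hκ.exists_ne_mem_colourClass hd hfd
  obtain ⟨e, he⟩ := hs'.1.2
  have hfe := hκ.adj_of_ne hG hfree hs hs' hne hsf he
  have hed := hκ.adj_of_mem_repeatedColours hG hfree hf he.1 hfe
    ((mem_denseNonneighborSet_comm hd' hfd.1).2 hfd)
  exact (hκ.mem_denseNonneighborSet hs' he).2.2 hed.symm

theorem not_adj_of_mem_repeatedColours (hκ : IsBoundaryColouring G κ) (hG : IsTight G)
    (hfree : IsFreeOf twoP2AddP1 G) (hd : d ∈ repeatedColours G κ)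
    (he : e ∈ denseNonneighborSet G d) (hu : u ∈ colourClass G κ e) (ha : IsDense G a)
    (hda : G.Adj d a) : ¬ G.Adj u a := fun hua =>
  (hκ.mem_denseNonneighborSet hu ⟨ha, hua⟩).2.2
    (hκ.adj_of_mem_repeatedColours hG hfree hd ha hda he).symm

/-- Such an edge would induce a `2P₂ + P₁` together with `f` and an edge between the dense
neighbours of two vertices of colour `f`. -/
theorem not_adj_of_adj_repeatedColours (hκ : IsBoundaryColouring G κ) (hG : IsTight G)
    (hfree : IsFreeOf twoP2AddP1 G) (hd : d ∈ repeatedColours G κ)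
    (hf : f ∈ repeatedColours G κ) (hdf : G.Adj d f) (he : e ∈ denseNonneighborSet G d)
    (hu : u ∈ colourClass G κ e) (hs : s ∈ colourClass G κ d) : ¬ G.Adj u s := by
  intro hus
  have hd' := hκ.isDense_of_mem_repeatedColours hd
  have hf' := hκ.isDense_of_mem_repeatedColours hf
  obtain ⟨v₁, hv₁, v₂, hv₂, hne⟩ := hf
  obtain ⟨b₁, hb₁⟩ := hv₁.1.2
  obtain ⟨b₂, hb₂⟩ := hv₂.1.2
  have hfb₁ := hκ.mem_denseNonneighborSet hv₁ hb₁
  have hfb₂ := hκ.mem_denseNonneighborSet hv₂ hb₂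
  have hdb {b : V} := hκ.adj_of_mem_repeatedColours hG hfree (e := b) ⟨v₁, hv₁, v₂, hv₂, hne⟩ hd'
    hdf.symm
  have hub {b : V} := hκ.not_adj_of_mem_repeatedColours hG hfree hd he hu (a := b)
  have hsb {b : V} := hκ.not_adj_of_adj_colour hs (e := b)
  rcases hfree.adj_of_twoP2 hus (hκ.adj_of_ne hG hfree hv₁ hv₂ hne hb₁ hb₂)
    (hub hb₁.1 (hdb hfb₁)) (hub hb₂.1 (hdb hfb₂)) (hsb hb₁.1 (hdb hfb₁)) (hsb hb₂.1 (hdb hfb₂))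
    f with h | h | h | h
  · exact hub hf' hdf h.symm
  · exact hsb hf' hdf h.symm
  · exact hfb₁.2.2 h
  · exact hfb₂.2.2 h

theorem not_adj_repeatedColours (hκ : IsBoundaryColouring G κ) (hG : IsTight G)
    (hfree : IsFreeOf twoP2AddP1 G) (hd : d ∈ repeatedColours G κ)
    (hf : f ∈ repeatedColours G κ) : ¬ G.Adj d f := by
  intro hdf
  have hd' := hκ.isDense_of_mem_repeatedColours hd
  obtain ⟨s, hs, s', hs', hne⟩ := id hd
  obtain ⟨e, he⟩ := hs.1.2
  have hde := hκ.mem_denseNonneighborSet hs he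
  obtain ⟨u, hu, hud⟩ := hκ.exists_mem_colourClass he.1
    ((mem_denseNonneighborSet_comm hd' he.1).2 hde)
  have hus {s : V} := hκ.not_adj_of_adj_repeatedColours hG hfree hd hf hdf hde hu (s := s)
  rcases hfree.adj_of_twoP2 hud.2 he.2 (hus hs) (hκ.not_adj_colour hu)
    (fun h => hκ.not_adj_colour hs h.symm) hde.2.2 s' with h | h | h | h
  · exact hus hs' h.symm
  · exact hκ.not_adj_colour hs' h
  · exact hκ.not_adj_of_mem_colourClass hs' hs h
  · exact hκ.not_adj_of_ne hG hs hs' hne he h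

theorem subsingleton_repeatedColours (hκ : IsBoundaryColouring G κ) (hG : IsTight G)
    (hfree : IsFreeOf twoP2AddP1 G) : (repeatedColours G κ).Subsingleton := by
  intro d hd f hf
  by_contra hne
  exact hκ.notMem_denseNonneighborSet_of_mem_repeatedColours hG hfree hd hf
    ⟨hκ.isDense_of_mem_repeatedColours hf, hne, hκ.not_adj_repeatedColours hG hfree hd hf⟩

theorem denseNeighborSet_eq_denseNonneighborSet (hκ : IsBoundaryColouring G κ)
    (hs : s ∈ colourClass G κ d) (hd : d ∉ repeatedColours G κ) :
    denseNeighborSet G s = denseNonneighborSet G d := by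
  refine Set.Subset.antisymm (fun e => hκ.mem_denseNonneighborSet hs) fun e he => ?_
  obtain ⟨s', hs', hs'e⟩ := hκ.exists_mem_colourClass (hκ.isDense_of_mem_colourClass hs) he
  rwa [Set.not_nontrivial_iff.1 hd hs hs']

/-- If `v` had another colour `f`, its dense neighbours would be exactly the dense non-neighbours
of `f`, and none of `f = d`, `f ∼ d`, `f ≁ d` is compatible with the repeated colour `d`. -/
theorem mem_colourClass_of_subset (hκ : IsBoundaryColouring G κ) (hG : IsTight G)
    (hfree : IsFreeOf twoP2AddP1 G) (hd : d ∈ repeatedColours G κ) (hv : v ∈ boundary G)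
    (hvd : denseNeighborSet G v ⊆ denseNonneighborSet G d) : v ∈ colourClass G κ d := by
  by_contra hvc
  have hfd : κ v ≠ d := fun h => hvc ⟨hv, h⟩
  have hd' := hκ.isDense_of_mem_repeatedColours hd
  have hf : κ v ∉ repeatedColours G κ := fun h =>
    hfd (hκ.subsingleton_repeatedColours hG hfree h hd)
  have heq := hκ.denseNeighborSet_eq_denseNonneighborSet ⟨hv, rfl⟩ hf
  by_cases hadj : G.Adj d (κ v)
  · obtain ⟨e, he⟩ := hv.2
    exact (hκ.subset hv he).2.2 <|
      hκ.adj_of_mem_repeatedColours hG hfree hd (hκ.isDense hv) hadj (hvd he)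
  · have hdf : d ∈ denseNonneighborSet G (κ v) := ⟨hd', hfd, fun h => hadj h.symm⟩
    exact (hvd (heq ▸ hdf)).2.ne rfl

theorem isIndepSet_residue (hκ : IsBoundaryColouring G κ) (hG : IsTight G)
    (hfree : IsFreeOf twoP2AddP1 G) : G.IsIndepSet (residue G (repeatedColours G κ)) := by
  rintro u ⟨hu, d, hd, hud⟩ v ⟨hv, f, hf, hvf⟩ -
  obtain rfl := hκ.subsingleton_repeatedColours hG hfree hd hf
  exact hκ.not_adj_of_mem_colourClass (hκ.mem_colourClass_of_subset hG hfree hd hu hud)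
    (hκ.mem_colourClass_of_subset hG hfree hd hv hvf)

theorem exists_isAssignment (hκ : IsBoundaryColouring G κ) (hG : IsTight G)
    (hfree : IsFreeOf twoP2AddP1 G) : ∃ φ, IsAssignment G (repeatedColours G κ) φ := by
  have hvertex (e : V) : ∃ s, e ∈ demand G (repeatedColours G κ) → s ∈ colourClass G κ e := by
    by_cases he : e ∈ demand G (repeatedColours G κ)
    · obtain ⟨hdense, -, d, hd⟩ := he
      obtain ⟨s, hs, -⟩ := hκ.exists_mem_colourClass hdense hd
      exact ⟨s, fun _ => hs⟩
    · exact ⟨e, fun h => absurd h he⟩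
  choose φ hφ using hvertex
  refine ⟨φ, fun e he => ⟨(hφ e he).1, ?_⟩, fun e he e' he' h => ?_, fun {e} he =>
    hκ.denseNeighborSet_eq_denseNonneighborSet (hφ e he) he.2.1⟩
  · rintro ⟨hb, d, hd, hsub⟩
    have hed : e = d :=
      (hφ e he).2.symm.trans (hκ.mem_colourClass_of_subset hG hfree hd hb hsub).2
    exact he.2.1 (hed ▸ hd)
  · rw [← (hφ e he).2, h, (hφ e' he').2]

end IsBoundaryColouring

variable {G : SimpleGraph V}

theorem IsTight.hasTightBColouring_iff_isAdmissible (hG : IsTight G)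
    (hfree : IsFreeOf twoP2AddP1 G) :
    HasTightBColouring G ↔ ∃ X ⊆ {v | IsDense G v}, X.Subsingleton ∧ IsAdmissible G X := by
  rw [hG.hasTightBColouring_iff_isBoundaryColouring]
  constructor
  · rintro ⟨κ, hκ⟩
    exact ⟨repeatedColours G κ, fun _ => hκ.isDense_of_mem_repeatedColours,
      hκ.subsingleton_repeatedColours hG hfree, hκ.isIndepSet_residue hG hfree,
      hκ.exists_isAssignment hG hfree⟩
  · rintro ⟨X, hXdense, hX, hindep, φ, hφ⟩
    exact hφ.exists_isBoundaryColouring hG hXdense hX hindep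

end RepeatedColours

/-! ### A counting criterion -/

section Criterion

theorem exists_injOn_mapsTo_iff_ncard_fiber_le {α β γ : Type*} [Finite α] [Finite β] [Nonempty β]
    {s : Set α} {t : Set β} {f : α → γ} {g : β → γ} :
    (∃ φ : α → β, Set.MapsTo φ s t ∧ Set.InjOn φ s ∧ ∀ a ∈ s, g (φ a) = f a) ↔
      ∀ a ∈ s, {a' ∈ s | f a' = f a}.ncard ≤ {b ∈ t | g b = f a}.ncard := by
  constructor
  · rintro ⟨φ, hmaps, hinj, hφ⟩ a -
    exact Set.ncard_le_ncard_of_injOn φ (fun a' ha' => ⟨hmaps ha'.1, (hφ a' ha'.1).trans ha'.2⟩)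
      (hinj.mono (Set.sep_subset _ _))
  · intro hle
    have hfiber (c : γ) : ∃ φ : α → β, Set.MapsTo φ {a ∈ s | f a = c} {b ∈ t | g b = c} ∧
        Set.InjOn φ {a ∈ s | f a = c} := by
      refine Set.Finite.exists_injOn_of_encard_le (t := {b ∈ t | g b = c}) (Set.toFinite _) ?_
      obtain h | ⟨a, ha, rfl⟩ := {a ∈ s | f a = c}.eq_empty_or_nonempty
      · simp [h]
      · rw [← (Set.toFinite _).cast_ncard_eq, ← (Set.toFinite _).cast_ncard_eq]
        exact_mod_cast hle a ha
    choose φ hmaps hinj using hfiber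
    have hφ (a : α) (ha : a ∈ s) : φ (f a) a ∈ t ∧ g (φ (f a) a) = f a := hmaps (f a) ⟨ha, rfl⟩
    refine ⟨fun a => φ (f a) a, fun a ha => (hφ a ha).1,
      fun a ha a' ha' (h : φ (f a) a = φ (f a') a') => ?_, fun a ha => (hφ a ha).2⟩
    have hf : f a = f a' := by rw [← (hφ a ha).2, ← (hφ a' ha').2, h]
    exact hinj (f a) ⟨ha, rfl⟩ ⟨ha', hf.symm⟩ (by simpa only [hf] using h)

variable {V : Type*} [Fintype V] {G : SimpleGraph V} {X : Set V}

theorem exists_isAssignment_iff : (∃ φ, IsAssignment G X φ) ↔ ∀ e ∈ demand G X,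
    {e' ∈ demand G X | denseNonneighborSet G e' = denseNonneighborSet G e}.ncard ≤
      {v ∈ boundary G \ residue G X | denseNeighborSet G v = denseNonneighborSet G e}.ncard := by
  cases isEmpty_or_nonempty V
  · exact iff_of_true ⟨id, isEmptyElim, isEmptyElim, fun {e} => isEmptyElim e⟩ isEmptyElim
  · rw [← exists_injOn_mapsTo_iff_ncard_fiber_le]
    exact ⟨fun ⟨φ, hφ⟩ => ⟨φ, hφ.mapsTo, hφ.injOn, fun _ => hφ.denseNeighborSet_eq⟩,
      fun ⟨φ, hmaps, hinj, hφ⟩ => ⟨φ, hmaps, hinj, hφ _⟩⟩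

theorem lt_mDegree_iff {d : ℕ} :
    d < mDegree G ↔ d < {v | d ≤ (G.neighborSet v).ncard}.ncard := by
  classical
  have hcard (k : ℕ) : (Finset.univ.filter fun v => k ≤ G.degree v + 1).card =
      {v | k ≤ (G.neighborSet v).ncard + 1}.ncard := by
    simp only [Set.ncard_eq_toFinset_card', Set.toFinset_ofPred, degree_eq_ncard_neighborSet]
  simp only [mDegree, hcard]
  have hbdd : BddAbove {k : ℕ | k ≤ {v | k ≤ (G.neighborSet v).ncard + 1}.ncard} :=
    ⟨Nat.card V, fun k hk => (Set.mem_ofPred.1 hk).trans (Set.ncard_le_card _)⟩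
  constructor
  · intro h
    obtain ⟨k, hk, hdk⟩ := (lt_csSup_iff hbdd ⟨0, Nat.zero_le _⟩).1 h
    refine hdk.trans_le ((Set.mem_ofPred.1 hk).trans (Set.ncard_le_ncard fun v hv => ?_))
    exact Nat.le_of_succ_le_succ (hdk.trans_le hv)
  · intro h
    refine le_csSup hbdd ?_
    simpa [Nat.succ_le_iff] using h

theorem mDegree_le_card (G : SimpleGraph V) : mDegree G ≤ Fintype.card V := by
  by_contra! h
  exact (lt_mDegree_iff.1 h).not_ge (Nat.card_eq_fintype_card (α := V) ▸ Set.ncard_le_card _)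

theorem isDense_iff_forall {v : V} : IsDense G v ↔ ∀ d < Fintype.card V,
    d < {w | d ≤ (G.neighborSet w).ncard}.ncard → d ≤ (G.neighborSet v).ncard := by
  simp only [← lt_mDegree_iff, isDense_iff_mDegree_le]
  refine ⟨fun h d _ hd => Nat.le_of_lt_succ (hd.trans_le h), fun h => not_lt.1 fun hlt => ?_⟩
  exact Nat.not_succ_le_self _ (h _ (hlt.trans_le (mDegree_le_card G)) hlt)

end Criterion

/-! ### Deciding the criterion -/

section Decision

variable {k : ℕ}

theorem PolyTimeComputable.ncard_neighborSet (i : Fin k) :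
    PolyTimeComputable fun G x => (G.neighborSet (x i)).ncard :=
  PolyTimeComputable.ncard (P := fun G x v => G.Adj (x i) v) (.adj i.succ 0)

namespace PolyTimeDecidable

theorem isDense (i : Fin k) : PolyTimeDecidable fun G x => IsDense G (x i) := by
  have hcount : PolyTimeComputable fun G (x : Fin (k + 1) → _) =>
      {w | (x 0 : ℕ) ≤ (G.neighborSet w).ncard}.ncard :=
    PolyTimeComputable.ncard (P := fun G x w => (x 0 : ℕ) ≤ (G.neighborSet w).ncard)
      (le (.vertex 1) (.ncard_neighborSet 0))
  exact (forall_vertex (P := fun G x d => (d : ℕ) < {w | (d : ℕ) ≤ (G.neighborSet w).ncard}.ncard →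
    (d : ℕ) ≤ (G.neighborSet (x i)).ncard)
    ((lt (.vertex 0) hcount).imp (le (.vertex 0) (.ncard_neighborSet i.succ)))).congr
    fun _ _ => by rw [isDense_iff_forall, Fintype.card_fin, Fin.forall_iff]

theorem mem_denseNeighborSet (i j : Fin k) :
    PolyTimeDecidable fun G x => x j ∈ denseNeighborSet G (x i) :=
  (isDense j).and (adj i j)

theorem mem_denseNonneighborSet (i j : Fin k) :
    PolyTimeDecidable fun G x => x j ∈ denseNonneighborSet G (x i) :=
  (isDense j).and (((eq i j).not.and (adj i j).not).congr fun _ _ => Iff.rfl)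

theorem mem_boundary (i : Fin k) : PolyTimeDecidable fun G x => x i ∈ boundary G :=
  (isDense i).not.and <| exists_vertex (P := fun G x w => w ∈ denseNeighborSet G (x i))
    (mem_denseNeighborSet i.succ 0)

theorem subset {A B : ∀ {n : ℕ}, SimpleGraph (Fin n) → (Fin k → Fin n) → Set (Fin n)}
    (hA : PolyTimeDecidable fun G (x : Fin (k + 1) → _) => x 0 ∈ A G (Fin.tail x))
    (hB : PolyTimeDecidable fun G (x : Fin (k + 1) → _) => x 0 ∈ B G (Fin.tail x)) :
    PolyTimeDecidable fun G x => A G x ⊆ B G x :=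
  forall_vertex (P := fun G x w => w ∈ A G x → w ∈ B G x) (hA.imp hB)

theorem set_eq {A B : ∀ {n : ℕ}, SimpleGraph (Fin n) → (Fin k → Fin n) → Set (Fin n)}
    (hA : PolyTimeDecidable fun G (x : Fin (k + 1) → _) => x 0 ∈ A G (Fin.tail x))
    (hB : PolyTimeDecidable fun G (x : Fin (k + 1) → _) => x 0 ∈ B G (Fin.tail x)) :
    PolyTimeDecidable fun G x => A G x = B G x :=
  ((subset hA hB).and (subset hB hA)).congr fun _ _ => Set.Subset.antisymm_iff.symm

section Admissible

variable {X : ∀ {n : ℕ}, SimpleGraph (Fin n) → (Fin k → Fin n) → Set (Fin n)}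

theorem mem_residue (hX : PolyTimeDecidable fun G (x : Fin (k + 1) → _) => x 0 ∈ X G (Fin.tail x)) :
    PolyTimeDecidable fun G (x : Fin (k + 1) → _) => x 0 ∈ residue G (X G (Fin.tail x)) :=
  (mem_boundary 0).and <| exists_vertex
    (P := fun G x d => d ∈ X G (Fin.tail x) ∧
      denseNeighborSet G (x 0) ⊆ denseNonneighborSet G d) <|
    (hX.reindex (Fin.cons 0 fun i => i.succ.succ)).and <|
      subset (mem_denseNeighborSet 2 0) (mem_denseNonneighborSet 1 0)

theorem mem_demand (hX : PolyTimeDecidable fun G (x : Fin (k + 1) → _) => x 0 ∈ X G (Fin.tail x)) :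
    PolyTimeDecidable fun G (x : Fin (k + 1) → _) => x 0 ∈ demand G (X G (Fin.tail x)) :=
  (isDense 0).and <| hX.not.and <| exists_vertex
    (P := fun G (x : Fin (k + 1) → _) d => d ∈ denseNonneighborSet G (x 0))
    (mem_denseNonneighborSet 1 0)

theorem isIndepSet
    (hX : PolyTimeDecidable fun G (x : Fin (k + 1) → _) => x 0 ∈ X G (Fin.tail x)) :
    PolyTimeDecidable fun G x => G.IsIndepSet (X G x) := by
  have hpair := (hX.reindex (Fin.cons 1 fun i => i.succ.succ)).imp
    ((hX.reindex (Fin.cons 0 fun i => i.succ.succ)).imp (adj (k := k + 2) 1 0).not)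
  refine (forall_vertex (P := fun G x u => ∀ v, u ∈ X G x → v ∈ X G x → ¬ G.Adj u v)
    (forall_vertex (P := fun G x v => x 0 ∈ X G (Fin.tail x) → v ∈ X G (Fin.tail x) →
      ¬ G.Adj (x 0) v) hpair)).congr fun G x => ?_
  exact ⟨fun h u hu v hv _ => h u v hu hv, fun h u v hu hv huv => h hu hv huv.ne huv⟩

theorem exists_isAssignment
    (hX : PolyTimeDecidable fun G (x : Fin (k + 1) → _) => x 0 ∈ X G (Fin.tail x)) :
    PolyTimeDecidable fun G x => ∃ φ, IsAssignment G (X G x) φ := by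
  let skip : Fin (k + 1) → Fin (k + 2) := Fin.cons 0 fun i => i.succ.succ
  have hdemand := ((mem_demand hX).reindex skip).and <|
    set_eq (A := fun G x => denseNonneighborSet G (x 0))
      (B := fun G x => denseNonneighborSet G (x 1))
      (mem_denseNonneighborSet 1 0) (mem_denseNonneighborSet 2 0)
  have hsupply := ((mem_boundary 0).and ((mem_residue hX).reindex skip).not).and <|
    set_eq (A := fun G x => denseNeighborSet G (x 0)) (B := fun G x => denseNonneighborSet G (x 1))
      (mem_denseNeighborSet 1 0) (mem_denseNonneighborSet 2 0)
  exact (forall_vertex (P := fun G x e => e ∈ demand G (X G x) →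
    {e' ∈ demand G (X G x) | denseNonneighborSet G e' = denseNonneighborSet G e}.ncard ≤
      {v ∈ boundary G \ residue G (X G x) |
        denseNeighborSet G v = denseNonneighborSet G e}.ncard)
    ((mem_demand hX).imp (le (.ncard hdemand) (.ncard hsupply)))).congr
    fun _ _ => exists_isAssignment_iff.symm

theorem isAdmissible
    (hX : PolyTimeDecidable fun G (x : Fin (k + 1) → _) => x 0 ∈ X G (Fin.tail x)) :
    PolyTimeDecidable fun G x => IsAdmissible G (X G x) :=
  (isIndepSet (X := fun G x => residue G (X G x)) (mem_residue hX)).and (exists_isAssignment hX)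

theorem exists_isAdmissible : PolyTimeDecidable (k := 0) fun G _ =>
    ∃ X ⊆ {v | IsDense G v}, X.Subsingleton ∧ IsAdmissible G X := by
  have hempty := isAdmissible (k := 0) (X := fun _ _ => ∅) <|
    (eq 0 0).not.congr fun _ _ => iff_of_false (not_not.2 rfl) id
  have hsingleton := exists_vertex (k := 0) (P := fun G _ d => IsDense G d ∧ IsAdmissible G {d}) <|
    (isDense 0).and (isAdmissible (X := fun _ x => {x 0}) (eq 0 1))
  refine (hempty.or hsingleton).congr fun G _ => ⟨?_, ?_⟩
  · rintro (h | ⟨d, hd, h⟩)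
    · exact ⟨∅, Set.empty_subset _, Set.subsingleton_empty, h⟩
    · exact ⟨{d}, Set.singleton_subset_iff.2 hd, Set.subsingleton_singleton, h⟩
  · rintro ⟨X, hX, hsub, h⟩
    obtain rfl | ⟨d, rfl⟩ := hsub.eq_empty_or_singleton
    · exact .inl h
    · exact .inr ⟨d, hX rfl, h⟩

end Admissible

end PolyTimeDecidable

end Decision

end TightB

/-- Tight b-Chromatic Number (given a tight graph, decide whether it has a tight b-colouring)
is polynomial-time solvable for `(2P₂ + P₁)`-free graphs. -/
theorem mainTheorem5 :
    TightB.PolyTimeSolvableOn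
      (fun {_n} G => TightB.IsTight G ∧ TightB.IsFreeOf TightB.twoP2AddP1 G)
      (fun {_n} G => TightB.HasTightBColouring G) :=
  TightB.PolyTimeDecidable.exists_isAdmissible.polyTimeSolvableOn fun _ hG =>
    hG.1.hasTightBColouring_iff_isAdmissible hG.2
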